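/- For a finite group $G$ let $o(G)=\frac{1}{|G|}\sum_{x\in G}o(x)$ be the average order of its elements, where $o(x)$ denotes the order of $x$. (a) If $o(G)<2.4$, then $G$ is isomorphic to one of the following groups: (i) the cyclic group $C_3$ of order $3$; (ii) the dihedral group $D_8$ of order $8$; (iii) the symmetric group $S_3$; (iv) the generalized dihedral group $D(C_3\times C_3)=(C_3\times C_3)\rtimes C_2$, in which the generator of $C_2$ acts on $C_3\times C_3$ by inversion; (v) an elementary abelian $2$-group (the trivial group being regarded as one). (b) $o(G)<2$ if and only if $G$ is an elementary abelian $2$-group. -/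

import Mathlib

/-- `ψ(G)`, the sum of the orders of all elements of the finite group `G`. -/
noncomputable def sumOrders (G : Type*) [Group G] [Fintype G] : ℕ :=
  ∑ x : G, orderOf x

/-- The average order `o(G) = ψ(G) / |G|` of the finite group `G`. -/
noncomputable def averageOrder (G : Type*) [Group G] [Fintype G] : ℚ :=
  (sumOrders G : ℚ) / (Fintype.card G : ℚ)

/-- `G` is an elementary abelian `p`-group: it is abelian and `x ^ p = 1` for all `x`
(the trivial group is included). -/
def IsElementaryAbelianGroup (p : ℕ) (G : Type*) [Group G] : Prop :=
  (∀ x y : G, x * y = y * x) ∧ ∀ x : G, x ^ p = 1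

/-- The cyclic group of order `n`, written multiplicatively. -/
abbrev Cyc (n : ℕ) : Type := Multiplicative (ZMod n)

/-- The action of the cyclic group of order two on an abelian group `A` in which the generator
acts by inversion. -/
def inversionAction (A : Type*) [CommGroup A] : Cyc 2 →* MulAut A where
  toFun z := if z = 1 then 1 else MulEquiv.inv A
  map_one' := by simp
  map_mul' := by
    have key : ∀ z w : Cyc 2, (z = 1 ∧ z * w = w) ∨ (w = 1 ∧ z * w = z) ∨
        (z ≠ 1 ∧ w ≠ 1 ∧ z * w = 1) := by decide
    intro z w
    rcases key z w with ⟨h, h'⟩ | ⟨h, h'⟩ | ⟨h, h', h''⟩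
    · rw [h', if_pos h, one_mul]
    · rw [h', if_pos h, mul_one]
    · rw [h'', if_pos rfl, if_neg h, if_neg h']
      ext a
      simp

/-- The generalized dihedral group `D(A) = A ⋊ C₂` of an abelian group `A`, where the generator
of `C₂` acts on `A` by inversion. -/
abbrev GenDihedral (A : Type*) [CommGroup A] : Type _ :=
  A ⋊[inversionAction A] Cyc 2

/-! ### Recognition of generalized dihedral groups -/

section Recognition

variable {G : Type*} [Group G]

/-! Write n = |G|, ψ for the sum of the orders and i for the number of solutions of x² = 1. The
hypothesis of (a) is 5ψ < 12n, and a small ψ forces many involutions.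

If no element has order 3, non-involutive elements have order at least 4, so 4n ≤ ψ + 2i + 1
(`card_mul_le_sumOrders_add`). Either i > 3n/4, and G is elementary abelian, or only n = 8, i = 6
survives, which is D_8. The analogous bound 3n ≤ ψ + i + 1 gives (b).

If y has order 3, orders are estimated on the cosets x⟨y⟩: two involutions in one coset force x to
invert y. With c elements centralizing y and d inverting it (d is 0 or c), `eight_mul_card_add_le`
leaves n = 3, or n = 2c with n = 6, 12 or 18. An element of order 6 rules out 12; for 18 the
estimate is tight, which determines every order. -/

theorem mul_self_of_orderOf_eq_two {x : G} (hx : orderOf x = 2) : x * x = 1 := by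
  rw [← sq, ← hx, pow_orderOf_eq_one]

theorem isElementaryAbelianGroup_two_of_mul_self (h : ∀ x : G, x * x = 1) :
    IsElementaryAbelianGroup 2 G := by
  refine ⟨fun x y => ?_, fun x => by rw [sq, h]⟩
  have hi : ∀ x : G, x⁻¹ = x := fun x => inv_eq_of_mul_eq_one_right (h x)
  have := hi (x * y)
  rw [mul_inv_rev, hi, hi] at this
  exact this.symm

theorem conj_eq_inv_of_mul_self {x y : G} (hx : x * x = 1) (hxy : (x * y) * (x * y) = 1) :
    x * y * x⁻¹ = y⁻¹ := by
  rw [inv_eq_of_mul_eq_one_right hx]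
  exact eq_inv_of_mul_eq_one_left (by rw [mul_assoc (x * y)]; exact hxy)

theorem not_commute_of_conj_eq_inv {x y : G} (hy : orderOf y = 3) (h : x * y * x⁻¹ = y⁻¹) :
    ¬ Commute x y := by
  intro hc
  rw [hc.eq, mul_assoc, mul_inv_cancel, mul_one] at h
  have : orderOf y ∣ 2 := orderOf_dvd_of_pow_eq_one (by rw [sq]; nth_rw 1 [h]; simp)
  rw [hy] at this
  omega

theorem mul_mul_self_of_orderOf_eq_three {y : G} (hy : orderOf y = 3) : y * y * y = 1 := by
  rw [← pow_three', ← hy, pow_orderOf_eq_one]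

theorem card_cyc (n : ℕ) : Nat.card (Cyc n) = n :=
  (Nat.card_congr Multiplicative.toAdd).trans (Nat.card_zmod n)

/-- The homomorphism from the cyclic group of order two determined by an element `s` with
`s * s = 1`. -/
def involutionHom (s : G) (hs : s * s = 1) : Cyc 2 →* G where
  toFun z := if z = 1 then 1 else s
  map_one' := by simp
  map_mul' := by
    have key : ∀ z w : Cyc 2, (z = 1 ∧ z * w = w) ∨ (w = 1 ∧ z * w = z) ∨
        (z ≠ 1 ∧ w ≠ 1 ∧ z * w = 1) := by decide
    intro z w
    rcases key z w with ⟨h, h'⟩ | ⟨h, h'⟩ | ⟨h, h', h''⟩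
    · rw [h', if_pos h, one_mul]
    · rw [h', if_pos h, mul_one]
    · rw [h'', if_pos rfl, if_neg h, if_neg h', hs]

theorem card_genDihedral (A : Type*) [CommGroup A] :
    Nat.card (GenDihedral A) = 2 * Nat.card A := by
  rw [SemidirectProduct.card, mul_comm]
  rw [card_cyc]

/-- `hinv` lets `f` and z ↦ s glue to a map on the semidirect product. A kernel element outside A
would put s in the range of f, so the map is injective, and bijective by counting. -/
theorem nonempty_mulEquiv_genDihedral [Finite G] {A : Type*} [CommGroup A] (f : A →* G)
    (hf : Function.Injective f) (s : G) (hs : s * s = 1) (hsf : s ∉ f.range)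
    (hinv : ∀ a, s * f a * s⁻¹ = (f a)⁻¹) (hcard : Nat.card G = 2 * Nat.card A) :
    Nonempty (G ≃* GenDihedral A) := by
  have hcomp : ∀ g, f.comp (inversionAction A g).toMonoidHom =
      (MulAut.conj (involutionHom s hs g)).toMonoidHom.comp f := by
    intro g
    ext a
    by_cases hg : g = 1
    · simp [hg]
    · simp [inversionAction, involutionHom, hg, hinv]
  let F : GenDihedral A →* G := SemidirectProduct.lift f (involutionHom s hs) hcomp
  have hF : Function.Injective F := by
    rw [injective_iff_map_eq_one]
    rintro ⟨a, z⟩ h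
    have h' : f a * involutionHom s hs z = 1 := h
    by_cases hz : z = 1
    · subst hz
      rw [map_one, mul_one] at h'
      rw [(injective_iff_map_eq_one f).1 hf a h']
      rfl
    · have h2 : f a * s = 1 := by simpa [involutionHom, hz] using h'
      exact absurd ⟨a⁻¹, by rw [map_inv]; exact inv_eq_of_mul_eq_one_right h2⟩ hsf
  have hA : Finite (GenDihedral A) := Finite.of_injective F hF
  have hbij : Function.Bijective F :=
    (Nat.bijective_iff_injective_and_card F).2 ⟨hF, by rw [card_genDihedral, hcard]⟩
  exact ⟨(MulEquiv.ofBijective F hbij).symm⟩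

/-- An embedding of the cyclic group of order `n` onto the subgroup generated by an element of
order `n`. -/
theorem exists_cyc_hom {n : ℕ} (y : G) (hy : orderOf y = n) :
    ∃ f : Cyc n →* G, Function.Injective f ∧ f.range = Subgroup.zpowers y := by
  have e : Cyc n ≃* Subgroup.zpowers y :=
    mulEquivOfCyclicCardEq (by rw [Nat.card_zpowers, hy, card_cyc])
  refine ⟨(Subgroup.zpowers y).subtype.comp e.toMonoidHom,
    (Subgroup.subtype_injective _).comp e.injective, ?_⟩
  rw [MonoidHom.range_comp, MonoidHom.range_eq_top.2 e.surjective, ← MonoidHom.range_eq_map,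
    Subgroup.range_subtype]

theorem conj_eq_inv_of_mem_zpowers {s y a : G} (h : s * y * s⁻¹ = y⁻¹)
    (ha : a ∈ Subgroup.zpowers y) : s * a * s⁻¹ = a⁻¹ := by
  obtain ⟨k, rfl⟩ := ha
  change s * y ^ k * s⁻¹ = (y ^ k)⁻¹
  rw [← conj_zpow, h, inv_zpow]

theorem nonempty_mulEquiv_genDihedral_cyc [Finite G] {n : ℕ} (y s : G) (hy : orderOf y = n)
    (hs : s * s = 1) (hsy : s ∉ Subgroup.zpowers y) (hinv : s * y * s⁻¹ = y⁻¹)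
    (hcard : Nat.card G = 2 * n) : Nonempty (G ≃* GenDihedral (Cyc n)) := by
  obtain ⟨f, hf, hr⟩ := exists_cyc_hom y hy
  refine nonempty_mulEquiv_genDihedral f hf s hs (hr ▸ hsy)
    (fun a => conj_eq_inv_of_mem_zpowers hinv (hr ▸ ⟨a, rfl⟩)) ?_
  rw [hcard, card_cyc]

theorem nonempty_dihedralGroup_four_mulEquiv :
    Nonempty (DihedralGroup 4 ≃* GenDihedral (Cyc 4)) := by
  refine nonempty_mulEquiv_genDihedral_cyc (DihedralGroup.r 1) (DihedralGroup.sr 0)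
    DihedralGroup.orderOf_r_one (by decide) ?_ (by decide) DihedralGroup.nat_card
  rintro ⟨k, hk⟩
  simp at hk

theorem nonempty_perm_fin_three_mulEquiv :
    Nonempty (Equiv.Perm (Fin 3) ≃* GenDihedral (Cyc 3)) := by
  refine nonempty_mulEquiv_genDihedral_cyc (finRotate 3) (Equiv.swap 0 1)
    (orderOf_eq_prime (by decide) (by decide)) (by decide) ?_ (by decide) ?_
  · intro h
    obtain ⟨k, hk⟩ := h
    have hc : Equiv.swap 0 1 * finRotate 3 = finRotate 3 * Equiv.swap 0 1 := by
      rw [← hk]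
      exact (Commute.refl (finRotate 3)).zpow_left k
    exact absurd hc (by decide)
  · rw [Nat.card_eq_fintype_card, Fintype.card_perm]
    rfl

theorem nonempty_mulEquiv_genDihedral_cyc_three_prod [Finite G] (y w s : G)
    (hy : orderOf y = 3) (hw : orderOf w = 3) (hyw : Commute y w)
    (hwy : w ∉ Subgroup.zpowers y) (hs : s * s = 1) (hsy : s * y * s⁻¹ = y⁻¹)
    (hsw : s * w * s⁻¹ = w⁻¹) (hscomm : ¬ Commute s y) (hcard : Nat.card G = 18) :
    Nonempty (G ≃* GenDihedral (Cyc 3 × Cyc 3)) := by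
  obtain ⟨f, hf, hfr⟩ := exists_cyc_hom y hy
  obtain ⟨g, hg, hgr⟩ := exists_cyc_hom w hw
  have hfm : ∀ a, f a ∈ Subgroup.zpowers y := fun a => hfr ▸ ⟨a, rfl⟩
  have hgm : ∀ a, g a ∈ Subgroup.zpowers w := fun a => hgr ▸ ⟨a, rfl⟩
  have hcomm : ∀ a b, Commute (f a) (g b) := by
    intro a b
    obtain ⟨k, hk⟩ := hfm a
    obtain ⟨l, hl⟩ := hgm b
    rw [← hk, ← hl]
    exact hyw.zpow_zpow k l
  have hdisj : Disjoint f.range g.range := by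
    rw [hfr, hgr]
    have : Fact (Nat.Prime 3) := ⟨Nat.prime_three⟩
    have hcw : Nat.card (Subgroup.zpowers w) = 3 := by rw [Nat.card_zpowers, hw]
    rw [disjoint_iff]
    by_contra hne
    have hdvd := Subgroup.card_dvd_of_le
      (inf_le_right : Subgroup.zpowers y ⊓ Subgroup.zpowers w ≤ _)
    rw [hcw, Nat.dvd_prime Nat.prime_three] at hdvd
    rcases hdvd with h | h
    · exact hne (Subgroup.card_eq_one.1 h)
    · have := Subgroup.eq_of_le_of_card_ge
        (inf_le_right : Subgroup.zpowers y ⊓ Subgroup.zpowers w ≤ _) (by rw [hcw, h])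
      exact hwy (inf_eq_right.1 this (Subgroup.mem_zpowers w))
  refine nonempty_mulEquiv_genDihedral (MonoidHom.noncommCoprod f g hcomm)
    ((MonoidHom.noncommCoprod_injective f g hcomm).2 ⟨hf, hg, hdisj⟩) s hs ?_ ?_ ?_
  · rintro ⟨⟨a, b⟩, hab⟩
    apply hscomm
    rw [← hab, MonoidHom.noncommCoprod_apply]
    obtain ⟨k, hk⟩ := hfm a
    obtain ⟨l, hl⟩ := hgm b
    simp only [← hk, ← hl]
    exact ((Commute.refl y).zpow_left k).mul_left (hyw.symm.zpow_left l)
  · rintro ⟨a, b⟩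
    rw [MonoidHom.noncommCoprod_apply, ← conj_mul, conj_eq_inv_of_mem_zpowers hsy (hfm a),
      conj_eq_inv_of_mem_zpowers hsw (hgm b), ← mul_inv_rev, (hcomm a b).eq]
  · rw [hcard, Nat.card_prod, card_cyc]

end Recognition

/-! ### Counting solutions of x² = 1 -/

section Sums

variable {G : Type*} [Group G] [Fintype G]

theorem averageOrder_lt_iff (q : ℚ) :
    averageOrder G < q ↔ (sumOrders G : ℚ) < q * Fintype.card G := by
  rw [averageOrder, div_lt_iff₀ (by exact_mod_cast Fintype.card_pos)]

open Classical in
/-- The number of solutions of `x * x = 1`. -/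
noncomputable def numInvolutive (G : Type*) [Group G] [Fintype G] : ℕ :=
  (Finset.univ.filter fun x : G => x * x = 1).card

theorem one_le_orderOf (x : G) : 1 ≤ orderOf x := orderOf_pos x

theorem two_le_orderOf {x : G} (hx : x ≠ 1) : 2 ≤ orderOf x := by
  have := one_le_orderOf x
  have : orderOf x ≠ 1 := fun h => hx (orderOf_eq_one_iff.1 h)
  omega

theorem three_le_orderOf {x : G} (hx : x * x ≠ 1) : 3 ≤ orderOf x := by
  have h1 : x ≠ 1 := by
    rintro rfl
    simp at hx
  have h2 := two_le_orderOf h1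
  have : orderOf x ≠ 2 := fun h => hx (mul_self_of_orderOf_eq_two h)
  omega

open Classical in
theorem sum_ite_eq_one (m : ℕ) : ∑ x : G, (if x = 1 then m else 0) = m := by simp

open Classical in
/-- If every non-involutive element has order at least `m + 2` then
`(m + 2) |G| ≤ ψ(G) + m i + 1`, where `i` is the number of involutive elements. -/
theorem card_mul_le_sumOrders_add (m : ℕ) (h : ∀ x : G, x * x ≠ 1 → m + 2 ≤ orderOf x) :
    (m + 2) * Fintype.card G ≤ sumOrders G + m * numInvolutive G + 1 := by
  have key : ∑ _x : G, (m + 2) ≤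
      ∑ x : G, (orderOf x + (if x * x = 1 then m else 0) + (if x = 1 then 1 else 0)) := by
    refine Finset.sum_le_sum fun x _ => ?_
    by_cases h1 : x = 1
    · simp [h1]
    · have := two_le_orderOf h1
      by_cases h2 : x * x = 1
      · simp [h1, h2]; omega
      · simpa [h1, h2] using h x h2
  rw [Finset.sum_add_distrib (g := fun x : G => if x = 1 then 1 else 0), sum_ite_eq_one,
    Finset.sum_add_distrib (f := orderOf), ← Finset.sum_filter] at key
  simp only [Finset.sum_const, smul_eq_mul, Finset.card_univ] at key
  rw [sumOrders, numInvolutive, mul_comm m, mul_comm (m + 2)]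
  exact key

theorem numInvolutive_le_card : numInvolutive G ≤ Fintype.card G := by
  classical
  exact Finset.card_le_univ _

theorem mul_self_eq_one_of_card_le (h : Fintype.card G ≤ numInvolutive G) (x : G) :
    x * x = 1 := by
  classical
  have := Finset.eq_univ_of_card _ (le_antisymm numInvolutive_le_card h)
  have hx := Finset.mem_univ x
  rw [← this] at hx
  exact (Finset.mem_filter.1 hx).2

theorem averageOrder_lt_two_iff : averageOrder G < 2 ↔ IsElementaryAbelianGroup 2 G := by
  rw [averageOrder_lt_iff]
  constructor
  · intro h
    have h' : sumOrders G < 2 * Fintype.card G := by exact_mod_cast h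
    have := card_mul_le_sumOrders_add (G := G) 1 fun x hx => three_le_orderOf hx
    exact isElementaryAbelianGroup_two_of_mul_self (mul_self_eq_one_of_card_le (by omega))
  · rintro ⟨-, h⟩
    have : sumOrders G < ∑ _x : G, 2 := by
      refine Finset.sum_lt_sum (fun x _ => orderOf_le_of_pow_eq_one two_pos (h x))
        ⟨1, Finset.mem_univ _, by simp⟩
    rw [Finset.sum_const, smul_eq_mul, mul_comm, Finset.card_univ] at this
    exact_mod_cast this

-- Inversion preserves the non-involutive elements, and a lone one would be its own inverse.
open Classical in
theorem numInvolutive_add_one_ne_card : numInvolutive G + 1 ≠ Fintype.card G := by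
  intro h
  have hJ := Finset.card_filter_add_card_filter_not (s := (Finset.univ : Finset G))
    (fun x : G => x * x = 1)
  rw [Finset.card_univ, ← h] at hJ
  obtain ⟨r, hr⟩ := Finset.card_eq_one.1 (Nat.add_left_cancel hJ)
  have hrJ : r ∈ Finset.univ.filter fun x : G => ¬ x * x = 1 := by simp [hr]
  have hrr : ¬ r * r = 1 := (Finset.mem_filter.1 hrJ).2
  have hri : r⁻¹ ∈ Finset.univ.filter fun x : G => ¬ x * x = 1 :=
    Finset.mem_filter.2 ⟨Finset.mem_univ _, by rwa [← mul_inv_rev, inv_eq_one]⟩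
  rw [hr, Finset.mem_singleton] at hri
  exact hrr (by nth_rw 1 [← hri]; simp)

open Classical in
/-- A group in which more than three quarters of the elements satisfy `x * x = 1` is an
elementary abelian `2`-group. -/
theorem isElementaryAbelianGroup_two_of_card_lt
    (h : 3 * Fintype.card G < 4 * numInvolutive G) : IsElementaryAbelianGroup 2 G := by
  let I : Finset G := Finset.univ.filter fun x : G => x * x = 1
  have hI : I.card = numInvolutive G := rfl
  have big : ∀ H : Subgroup G, ∀ S : Finset G, (∀ x ∈ S, x ∈ H) →
      Fintype.card G < 2 * S.card → H = ⊤ := by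
    intro H S hS hc
    rw [← Subgroup.index_eq_one]
    have h1 : S.card ≤ Nat.card H := by
      rw [← SetLike.coe_sort_coe, Nat.card_coe_set_eq]
      exact Set.ncard_coe_finset S ▸ Set.ncard_le_ncard (fun x hx => hS x hx)
    have h2 := H.card_mul_index
    rw [Nat.card_eq_fintype_card (α := G)] at h2
    have h3 : H.index ≠ 0 := H.index_ne_zero_of_finite
    by_contra h4
    have h5 : 2 ≤ H.index := by omega
    have := Nat.mul_le_mul_left (Nat.card H) h5
    omega
  have hcent : ∀ a ∈ I, a ∈ Subgroup.center G := by
    intro a ha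
    have haa : a * a = 1 := (Finset.mem_filter.1 ha).2
    have htop : Subgroup.centralizer {a} = ⊤ := by
      -- If a, z and az all square to 1, then az = za; and |I ∩ aI| ≥ 2|I| − |G| > |G|/2.
      refine big _ (I ∩ I.image (a * ·)) ?_ ?_
      · intro x hx
        obtain ⟨hx1, hx2⟩ := Finset.mem_inter.1 hx
        obtain ⟨z, hz, rfl⟩ := Finset.mem_image.1 hx2
        have hzz : z * z = 1 := (Finset.mem_filter.1 hz).2
        have hx1' : (a * z) * (a * z) = 1 := (Finset.mem_filter.1 hx1).2
        have h1 : (a * z)⁻¹ = a * z := inv_eq_of_mul_eq_one_right hx1'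
        rw [mul_inv_rev, inv_eq_of_mul_eq_one_right haa, inv_eq_of_mul_eq_one_right hzz] at h1
        rw [Subgroup.mem_centralizer_singleton_iff]
        calc a * z * a = z * a * a := by rw [h1]
          _ = z := by rw [mul_assoc, haa, mul_one]
          _ = a * a * z := by rw [haa, one_mul]
          _ = a * (a * z) := by rw [mul_assoc]
      · have h1 := Finset.card_union_add_card_inter I (I.image (a * ·))
        rw [Finset.card_image_of_injective _ (mul_right_injective a)] at h1
        have h2 := Finset.card_le_univ (I ∪ I.image (a * ·))
        omega
    rw [Subgroup.mem_center_iff]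
    intro g
    have hg : g ∈ Subgroup.centralizer {a} := htop ▸ Subgroup.mem_top g
    rw [Subgroup.mem_centralizer_singleton_iff] at hg
    exact hg
  have hall : Subgroup.center G = ⊤ := big _ I hcent (by omega)
  have hcomm : ∀ x y : G, x * y = y * x := fun x y =>
    Subgroup.mem_center_iff.1 (hall ▸ Subgroup.mem_top y) x
  let K : Subgroup G :=
    { carrier := {x | x * x = 1}
      one_mem' := by simp
      mul_mem' := by
        intro x y (hx : x * x = 1) (hy : y * y = 1)
        change x * y * (x * y) = 1
        rw [mul_assoc, hcomm y, mul_assoc, hy, mul_one, hx]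
      inv_mem' := by
        intro x (hx : x * x = 1)
        change x⁻¹ * x⁻¹ = 1
        rw [← mul_inv_rev, hx, inv_one] }
  have hK : K = ⊤ := big K I (fun x hx => (Finset.mem_filter.1 hx).2) (by omega)
  exact ⟨hcomm, fun x => by rw [sq]; exact (hK ▸ Subgroup.mem_top x : x ∈ K)⟩

open Classical in
theorem nonempty_mulEquiv_dihedralGroup_four (hn : Fintype.card G = 8)
    (hi : numInvolutive G = 6) (h3 : ∀ x : G, orderOf x ≠ 3) :
    Nonempty (G ≃* DihedralGroup 4) := by
  let J : Finset G := Finset.univ.filter fun x : G => ¬ x * x = 1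
  have hJ : J.card = 2 := by
    have := Finset.card_filter_add_card_filter_not (s := (Finset.univ : Finset G))
      (fun x : G => x * x = 1)
    rw [Finset.card_univ, hn] at this
    change numInvolutive G + J.card = 8 at this
    omega
  obtain ⟨r, hr⟩ : J.Nonempty := Finset.card_pos.1 (by omega)
  have hrr : r * r ≠ 1 := (Finset.mem_filter.1 hr).2
  have hri : r⁻¹ ≠ r := fun h => hrr (by nth_rw 1 [← h]; simp)
  have hsub : ({r, r⁻¹} : Finset G) ⊆ J := by
    intro x hx
    rw [Finset.mem_insert, Finset.mem_singleton] at hx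
    refine Finset.mem_filter.2 ⟨Finset.mem_univ _, ?_⟩
    rcases hx with rfl | rfl
    · exact hrr
    · rwa [← mul_inv_rev, inv_eq_one]
  have hJe : ({r, r⁻¹} : Finset G) = J :=
    Finset.eq_of_subset_of_card_le hsub (by rw [hJ, Finset.card_pair hri.symm])
  have hmem : ∀ x : G, x ≠ r → x ≠ r⁻¹ → x * x = 1 := by
    intro x h1 h2
    by_contra hx
    have : x ∈ J := Finset.mem_filter.2 ⟨Finset.mem_univ _, hx⟩
    rw [← hJe, Finset.mem_insert, Finset.mem_singleton] at this
    tauto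
  -- Only r and r⁻¹ are non-involutive, and r² is neither of them.
  have hr4 : r ^ 4 = 1 := by
    have h1 : r * r ≠ r := by
      intro h
      rw [mul_eq_left] at h
      exact hrr (by rw [h, one_mul])
    have h2 : r * r ≠ r⁻¹ := by
      intro h
      refine h3 r (orderOf_eq_prime (p := 3) ?_ fun h => hrr (by rw [h, one_mul]))
      rw [pow_succ, sq, h, inv_mul_cancel]
    rw [← hmem _ h1 h2, ← sq r, ← pow_add]
  have hor : orderOf r = 4 :=
    orderOf_eq_prime_pow (p := 2) (n := 1) (by rwa [pow_one, sq]) (by simpa using hr4)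
  obtain ⟨s, hs⟩ : ∃ s, s ∉ Subgroup.zpowers r := by
    by_contra! h
    have h' := (Subgroup.eq_top_iff' _).2 h
    have h2 := Nat.card_zpowers r
    rw [h', Subgroup.card_top, Nat.card_eq_fintype_card] at h2
    omega
  have hrm := Subgroup.mem_zpowers r
  have hs1 : s * s = 1 := hmem s (fun h => hs (h ▸ hrm)) (fun h => hs (h ▸ inv_mem hrm))
  have hs2 : (s * r) * (s * r) = 1 := hmem (s * r)
    (fun h => hs (by
      rw [mul_eq_right] at h
      exact h ▸ one_mem _))
    (fun h => hs (by
      rw [← eq_mul_inv_iff_mul_eq] at h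
      exact h ▸ mul_mem (inv_mem hrm) (inv_mem hrm)))
  obtain ⟨e⟩ := nonempty_mulEquiv_genDihedral_cyc r s hor hs1 hs (by
    rw [inv_eq_of_mul_eq_one_right hs1]
    exact eq_inv_of_mul_eq_one_left (by rw [mul_assoc (s * r)]; exact hs2))
    (by rw [Nat.card_eq_fintype_card, hn])
  obtain ⟨e'⟩ := nonempty_dihedralGroup_four_mulEquiv
  exact ⟨e.trans e'.symm⟩

end Sums

/-! ### Groups with an element of order three -/

section OrderThree

variable {G : Type*} [Group G]

/-- The order of `x`, modified to take the value `3` at the identity. -/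
noncomputable def modifiedOrder (x : G) : ℕ :=
  open Classical in orderOf x + if x = 1 then 2 else 0

theorem modifiedOrder_mul_of_commute {z y : G} (hz : orderOf z = 2) (hy : orderOf y = 3)
    (h : Commute z y) : 6 ≤ modifiedOrder (z * y) := by
  have := h.orderOf_mul_eq_mul_orderOf_of_coprime (by rw [hz, hy]; decide)
  rw [hz, hy] at this
  rw [modifiedOrder, this]
  omega

variable [Fintype G]

theorem sum_modifiedOrder : ∑ x : G, modifiedOrder x = sumOrders G + 2 := by
  classical
  simp only [modifiedOrder]
  rw [Finset.sum_add_distrib]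
  simp [sumOrders]

theorem orderOf_eq_two_or_three_le_modifiedOrder (x : G) :
    (orderOf x = 2 ∧ modifiedOrder x = 2) ∨ 3 ≤ modifiedOrder x := by
  by_cases h : x = 1
  · simp [modifiedOrder, h]
  · have := two_le_orderOf h
    simp only [modifiedOrder, h, if_false]
    omega

-- One involution in the coset makes the other two elements have order 6; otherwise all three terms
-- are at least 3. The modified value at the identity covers the coset ⟨y⟩.
open Classical in
theorem nine_le_modifiedOrder_add {y : G} (hy : orderOf y = 3) {x : G} (h : Commute x y) :
    9 ≤ modifiedOrder x + modifiedOrder (x * y) + modifiedOrder (x * y * y) := by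
  have hyyy : y * y * y = 1 := mul_mul_self_of_orderOf_eq_three hy
  have aux : ∀ z : G, orderOf z = 2 → Commute z y →
      6 ≤ modifiedOrder (z * y) ∧ 6 ≤ modifiedOrder (z * y * y) := by
    intro z hz hzy
    refine ⟨modifiedOrder_mul_of_commute hz hy hzy, ?_⟩
    rw [mul_assoc]
    refine modifiedOrder_mul_of_commute hz ?_ (hzy.mul_right hzy)
    have : y * y = y⁻¹ := eq_inv_of_mul_eq_one_left hyyy
    rw [this, orderOf_inv, hy]
  have hyy : Commute y y := Commute.refl y
  have e : x * y * y * y = x := by rw [mul_assoc, mul_assoc, ← mul_assoc y, hyyy, mul_one]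
  rcases orderOf_eq_two_or_three_le_modifiedOrder x with h1 | h1
  · have := aux x h1.1 h
    omega
  rcases orderOf_eq_two_or_three_le_modifiedOrder (x * y) with h2 | h2
  · have := aux _ h2.1 (h.mul_left hyy)
    rw [e] at this
    omega
  rcases orderOf_eq_two_or_three_le_modifiedOrder (x * y * y) with h3 | h3
  · have := aux _ h3.1 ((h.mul_left hyy).mul_left hyy)
    rw [e] at this
    omega
  omega

/-- All elements of x⟨y⟩ conjugate y alike, so two involutions there would make x invert y. Hence at
most one term is 2. -/
theorem eight_le_modifiedOrder_add {y : G} (hy : orderOf y = 3) {x : G}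
    (h : x * y * x⁻¹ ≠ y⁻¹) :
    8 ≤ modifiedOrder x + modifiedOrder (x * y) + modifiedOrder (x * y * y) := by
  have hyyy : y * y * y = 1 := mul_mul_self_of_orderOf_eq_three hy
  have e : x * y * y * y = x := by rw [mul_assoc, mul_assoc, ← mul_assoc y, hyyy, mul_one]
  have aux : ∀ z : G, z * y * z⁻¹ ≠ y⁻¹ → orderOf z = 2 → orderOf (z * y) ≠ 2 :=
    fun z hz h1 h2 => hz (conj_eq_inv_of_mul_self (mul_self_of_orderOf_eq_two h1)
      (mul_self_of_orderOf_eq_two h2))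
  have a1 := aux x h
  have a2 := aux (x * y) (by convert h using 1; group)
  have a3 := aux (x * y * y) (by convert h using 1; group)
  rw [e] at a3
  have b1 := orderOf_eq_two_or_three_le_modifiedOrder x
  have b2 := orderOf_eq_two_or_three_le_modifiedOrder (x * y)
  have b3 := orderOf_eq_two_or_three_le_modifiedOrder (x * y * y)
  omega

open Classical in
/-- The key estimate: averaging orders over the cosets of `⟨y⟩`. -/
theorem eight_mul_card_add_le {y : G} (hy : orderOf y = 3) :
    8 * Fintype.card G + (Finset.univ.filter fun x : G => Commute x y).card ≤
      3 * (sumOrders G + 2) +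
        2 * (Finset.univ.filter fun x : G => x * y * x⁻¹ = y⁻¹).card := by
  have key : ∑ x : G, (8 + if Commute x y then 1 else 0) ≤
      ∑ x : G, (modifiedOrder x + modifiedOrder (x * y) + modifiedOrder (x * y * y) +
        if x * y * x⁻¹ = y⁻¹ then 2 else 0) := by
    refine Finset.sum_le_sum fun x _ => ?_
    by_cases h1 : Commute x y
    · have := nine_le_modifiedOrder_add hy h1
      rw [if_pos h1]
      omega
    · rw [if_neg h1]
      by_cases h2 : x * y * x⁻¹ = y⁻¹
      · rw [if_pos h2]
        have b1 := orderOf_eq_two_or_three_le_modifiedOrder x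
        have b2 := orderOf_eq_two_or_three_le_modifiedOrder (x * y)
        have b3 := orderOf_eq_two_or_three_le_modifiedOrder (x * y * y)
        omega
      · have := eight_le_modifiedOrder_add hy h2
        rw [if_neg h2]
        omega
  simp only [Finset.sum_add_distrib] at key
  have s1 : ∑ x : G, modifiedOrder (x * y) = ∑ x : G, modifiedOrder x :=
    Equiv.sum_comp (Equiv.mulRight y) modifiedOrder
  have s2 : ∑ x : G, modifiedOrder (x * y * y) = ∑ x : G, modifiedOrder (x * y) :=
    Equiv.sum_comp (Equiv.mulRight y) fun x => modifiedOrder (x * y)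
  rw [s2, s1, sum_modifiedOrder, ← Finset.sum_filter, ← Finset.sum_filter] at key
  simp only [Finset.sum_const, smul_eq_mul, Finset.card_univ] at key
  omega

open Classical in
theorem card_filter_commute (y : G) :
    (Finset.univ.filter fun x : G => Commute x y).card =
      Nat.card (Subgroup.centralizer {y}) := by
  rw [Nat.card_eq_fintype_card, Fintype.card_subtype]
  congr 1
  ext x
  rw [Finset.mem_filter_univ, Finset.mem_filter_univ, Subgroup.mem_centralizer_singleton_iff]
  rfl

-- The inverting elements form the coset of the centralizer through x₀.
open Classical in
theorem card_filter_inverting {x₀ y : G} (hx₀ : x₀ * y * x₀⁻¹ = y⁻¹) :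
    (Finset.univ.filter fun x : G => x * y * x⁻¹ = y⁻¹).card =
      (Finset.univ.filter fun x : G => Commute x y).card := by
  symm
  refine Finset.card_bij (fun x _ => x₀ * x) ?_ (fun a _ b _ h => mul_left_cancel h) ?_
  · intro x hx
    have hx' : Commute x y := (Finset.mem_filter.1 hx).2
    refine Finset.mem_filter.2 ⟨Finset.mem_univ _, ?_⟩
    rw [← hx₀, mul_inv_rev, mul_assoc x₀ x y, hx'.eq]
    group
  · intro x hx
    have hx' : x * y * x⁻¹ = y⁻¹ := (Finset.mem_filter.1 hx).2
    refine ⟨x₀⁻¹ * x, Finset.mem_filter.2 ⟨Finset.mem_univ _, ?_⟩, by group⟩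
    have h1 : x * y = y⁻¹ * x := by rw [← hx']; group
    have h2 : x₀⁻¹ * y⁻¹ = y * x₀⁻¹ := by rw [← hx₀]; group
    change x₀⁻¹ * x * y = y * (x₀⁻¹ * x)
    rw [mul_assoc, h1, ← mul_assoc, h2, mul_assoc]

/-- Possible orders of `G` when it has an element `y` of order three. -/
theorem card_eq_of_orderOf_eq_three {y : G} (hy : orderOf y = 3)
    (h : 5 * sumOrders G < 12 * Fintype.card G) :
    Fintype.card G = 3 ∨ ∃ x : G, x * y * x⁻¹ = y⁻¹ ∧
      Fintype.card G = 2 * Nat.card (Subgroup.centralizer {y}) ∧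
      (Fintype.card G = 6 ∨ Fintype.card G = 12 ∨ Fintype.card G = 18) := by
  classical
  have key := eight_mul_card_add_le hy
  have hyC : y ∈ Subgroup.centralizer {y} := by
    rw [Subgroup.mem_centralizer_singleton_iff]
  have h3 : 3 ∣ Nat.card (Subgroup.centralizer {y}) := by
    rw [← hy, ← Nat.card_zpowers]
    exact Subgroup.card_dvd_of_le (by rwa [Subgroup.zpowers_le])
  have hpos : 0 < Nat.card (Subgroup.centralizer {y}) := Nat.card_pos
  obtain ⟨k, hk⟩ := (Subgroup.centralizer {y}).card_subgroup_dvd_card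
  rw [Nat.card_eq_fintype_card (α := G)] at hk
  by_cases hD : ∃ x : G, x * y * x⁻¹ = y⁻¹
  · right
    obtain ⟨x, hx⟩ := hD
    refine ⟨x, hx, ?_⟩
    have hxc := not_commute_of_conj_eq_inv hy hx
    rw [card_filter_inverting hx, card_filter_commute] at key
    -- Now `key` and `h` give 4n/5 < c + 6, where n = kc and c ≥ 3. This excludes k ≥ 4, allows k =
    -- 3 only for n = 9, and for k = 2 gives c < 10 with 3 ∣ c.
    set c := Nat.card (Subgroup.centralizer {y}) with hc
    have hk1 : k ≠ 1 := by
      rintro rfl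
      rw [mul_one] at hk
      have : Subgroup.centralizer {y} = ⊤ :=
        Subgroup.eq_top_of_card_eq _ (by rw [Nat.card_eq_fintype_card (α := G), hk])
      have hx' : x ∈ Subgroup.centralizer {y} := this ▸ Subgroup.mem_top x
      rw [Subgroup.mem_centralizer_singleton_iff] at hx'
      exact hxc hx'
    have hk3 : k ≠ 3 := by
      rintro rfl
      have h9 : Fintype.card G = 9 := by omega
      have hx9 : x ^ 9 = 1 := h9 ▸ pow_card_eq_one
      apply hxc
      have hx2 : Commute (x ^ 2) y := by
        have h1 : x * y = y⁻¹ * x := by rw [← hx]; group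
        have h2 : x * y⁻¹ = y * x := by
          have : x * y⁻¹ * x⁻¹ = y := by rw [← conj_inv, hx, inv_inv]
          nth_rw 2 [← this]
          group
        change x ^ 2 * y = y * x ^ 2
        rw [sq, mul_assoc, h1, ← mul_assoc, h2, mul_assoc]
      -- In odd order x is a power of x², which centralizes y.
      have e : x = (x ^ 2) ^ 5 := by
        rw [← pow_mul, show 2 * 5 = 9 + 1 from rfl, pow_succ, hx9, one_mul]
      rw [e]
      exact hx2.pow_left 5
    have hk4 : k < 4 := by
      by_contra! h4
      have := Nat.mul_le_mul_left c h4
      omega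
    have hk2 : k = 2 := by
      have : k ≠ 0 := by
        rintro rfl
        have := Fintype.card_pos (α := G)
        omega
      omega
    subst hk2
    omega
  · left
    have hD' : (Finset.univ.filter fun x : G => x * y * x⁻¹ = y⁻¹).card = 0 := by
      rw [Finset.card_eq_zero, Finset.filter_eq_empty_iff]
      exact fun x _ hx => hD ⟨x, hx⟩
    rw [hD', card_filter_commute] at key
    have h3' : 3 ∣ Fintype.card G := h3.trans ⟨k, hk⟩
    have := Fintype.card_pos (α := G)
    -- Here 4n/5 + c < 6 with c ≥ 3 and 3 ∣ n.
    omega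

/-- The inverting element x need not be given as an involution, but x³ still inverts y and squares
to 1. -/
theorem nonempty_mulEquiv_perm_fin_three {x y : G} (hy : orderOf y = 3)
    (hx : x * y * x⁻¹ = y⁻¹) (hn : Fintype.card G = 6) :
    Nonempty (G ≃* Equiv.Perm (Fin 3)) := by
  have hx' : x * y⁻¹ * x⁻¹ = y := by rw [← conj_inv, hx, inv_inv]
  have h3 : x ^ 3 * y * (x ^ 3)⁻¹ = y⁻¹ := by
    calc x ^ 3 * y * (x ^ 3)⁻¹ = x * (x * (x * y * x⁻¹) * x⁻¹) * x⁻¹ := by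
          simp only [pow_three, mul_inv_rev, mul_assoc]
      _ = y⁻¹ := by rw [hx, hx', hx]
  have h6 : x ^ 3 * x ^ 3 = 1 := by
    rw [← pow_add, ← pow_card_eq_one (x := x), hn]
  obtain ⟨e⟩ := nonempty_mulEquiv_genDihedral_cyc y (x ^ 3) hy h6 (fun h => by
    obtain ⟨k, hk⟩ := h
    refine not_commute_of_conj_eq_inv hy h3 ?_
    rw [← hk]
    exact (Commute.refl y).zpow_left k) h3 (by rw [Nat.card_eq_fintype_card, hn])
  obtain ⟨e'⟩ := nonempty_perm_fin_three_mulEquiv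
  exact ⟨e.trans e'.symm⟩

theorem le_sumOrders_of_card_eq_twelve {y : G} (hy : orderOf y = 3)
    (hn : Fintype.card G = 12) (hc : Nat.card (Subgroup.centralizer {y}) = 6) :
    31 ≤ sumOrders G := by
  classical
  have : Fact (Nat.Prime 2) := ⟨Nat.prime_two⟩
  obtain ⟨⟨z, hzC⟩, hz⟩ := exists_prime_orderOf_dvd_card' (G := Subgroup.centralizer {y}) 2
    (by rw [hc]; decide)
  rw [Subgroup.orderOf_mk] at hz
  have hzy : Commute z y := Subgroup.mem_centralizer_singleton_iff.1 hzC
  have h6 : orderOf (z * y) = 6 := by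
    rw [hzy.orderOf_mul_eq_mul_orderOf_of_coprime (by rw [hz, hy]; decide), hz, hy]
  set w := z * y
  have hww : w ≠ w⁻¹ := by
    intro h
    have : orderOf w ∣ 2 := orderOf_dvd_of_pow_eq_one (by rw [sq]; nth_rw 1 [h]; simp)
    rw [h6] at this
    omega
  -- Two elements of order 6 and a deficit of 1 at the identity: 2·12 + 4 + 4 − 1 = 31.
  have key : ∑ x : G, (2 + (if x = w then 4 else 0) + (if x = w⁻¹ then 4 else 0)) ≤
      ∑ x : G, (orderOf x + if x = 1 then 1 else 0) := by
    refine Finset.sum_le_sum fun x _ => ?_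
    by_cases h1 : x = w
    · subst h1
      rw [if_pos rfl, if_neg hww, h6]
      omega
    by_cases h2 : x = w⁻¹
    · rw [if_neg h1, if_pos h2, h2, orderOf_inv, h6]
      omega
    rw [if_neg h1, if_neg h2]
    by_cases h3 : x = 1
    · simp [h3]
    · have := two_le_orderOf h3
      omega
  simp only [Finset.sum_add_distrib, Finset.sum_ite_eq', Finset.mem_univ, if_true,
    Finset.sum_const, Finset.card_univ, hn, smul_eq_mul] at key
  rw [sumOrders]
  omega

theorem nonempty_mulEquiv_genDihedral_of_card_eq_eighteen {x y : G} (hy : orderOf y = 3)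
    (hx : x * y * x⁻¹ = y⁻¹) (hn : Fintype.card G = 18)
    (hc : Nat.card (Subgroup.centralizer {y}) = 9) (hψ : sumOrders G ≤ 43) :
    Nonempty (G ≃* GenDihedral (Cyc 3 × Cyc 3)) := by
  classical
  -- The centralizer has odd order 9, so f ≤ g pointwise, while the sums are 2·18 + 9 = 45 and ψ + 2
  -- ≤ 45. Equality everywhere gives order 3 on the nontrivial centralizer and order 2 outside it.
  let f : G → ℕ := fun x => 2 + if Commute x y then 1 else 0
  let g : G → ℕ := fun x => orderOf x + if x = 1 then 2 else 0
  have hodd : ∀ x : G, Commute x y → orderOf x ≠ 2 := by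
    intro x hx h2
    have hxC : x ∈ Subgroup.centralizer {y} := Subgroup.mem_centralizer_singleton_iff.2 hx
    have := Subgroup.orderOf_dvd_natCard _ hxC
    rw [hc, h2] at this
    omega
  have hle : ∀ x ∈ Finset.univ, f x ≤ g x := by
    intro x _
    simp only [f, g]
    by_cases h1 : x = 1
    · simp [h1]
    · have h2 := two_le_orderOf h1
      by_cases h3 : Commute x y
      · have := hodd x h3
        rw [if_pos h3]
        omega
      · rw [if_neg h3]
        omega
  have hsf : ∑ x, f x = 45 := by
    simp only [f]
    rw [Finset.sum_add_distrib, ← Finset.sum_filter, Finset.sum_const, Finset.sum_const,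
      card_filter_commute, hc, Finset.card_univ, hn]
    rfl
  have hsg : ∑ x, g x = sumOrders G + 2 := by
    simp only [g]
    rw [Finset.sum_add_distrib, sum_ite_eq_one, sumOrders]
  have heq := (Finset.sum_eq_sum_iff_of_le hle).1
    (le_antisymm (Finset.sum_le_sum hle) (by omega))
  have hC : ∀ x : G, Commute x y → x ≠ 1 → orderOf x = 3 := by
    intro x h1 h2
    simpa [f, g, h1, h2] using (heq x (Finset.mem_univ x)).symm
  have hI : ∀ x : G, ¬ Commute x y → x * x = 1 := by
    intro x h1
    have h2 : x ≠ 1 := fun h => h1 (h ▸ Commute.one_left y)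
    refine mul_self_of_orderOf_eq_two ?_
    simpa [f, g, h1, h2] using (heq x (Finset.mem_univ x)).symm
  have hxc := not_commute_of_conj_eq_inv hy hx
  obtain ⟨w, hwC, hw⟩ : ∃ w, Commute w y ∧ w ∉ Subgroup.zpowers y := by
    by_contra! h
    have h1 : Subgroup.centralizer {y} ≤ Subgroup.zpowers y := fun w hw =>
      h w (Subgroup.mem_centralizer_singleton_iff.1 hw)
    have h2 := Subgroup.card_le_of_le h1
    rw [hc, Nat.card_zpowers, hy] at h2
    omega
  have hw3 : orderOf w = 3 := hC w hwC (fun h => hw (h ▸ one_mem _))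
  have hxw : ¬ Commute (x * w) y := by
    intro h
    apply hxc
    have := h.mul_left hwC.inv_left
    rwa [mul_inv_cancel_right] at this
  exact nonempty_mulEquiv_genDihedral_cyc_three_prod y w x hy hw3 hwC.symm hw (hI x hxc) hx
    (conj_eq_inv_of_mul_self (hI x hxc) (hI _ hxw)) hxc (by rw [Nat.card_eq_fintype_card, hn])

end OrderThree

/-! ### The classification -/

theorem mainTheorem4 (G : Type*) [Group G] [Fintype G] :
    (averageOrder G < 2.4 →
      Nonempty (G ≃* Cyc 3) ∨
      Nonempty (G ≃* DihedralGroup 4) ∨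
      Nonempty (G ≃* Equiv.Perm (Fin 3)) ∨
      Nonempty (G ≃* GenDihedral (Cyc 3 × Cyc 3)) ∨
      IsElementaryAbelianGroup 2 G) ∧
    (averageOrder G < 2 ↔ IsElementaryAbelianGroup 2 G) := by
  refine ⟨fun h => ?_, averageOrder_lt_two_iff⟩
  rw [averageOrder_lt_iff] at h
  have hψ : 5 * sumOrders G < 12 * Fintype.card G := by
    have : (5 : ℚ) * sumOrders G < 12 * Fintype.card G := by linarith
    exact_mod_cast this
  by_cases h3 : ∃ y : G, orderOf y = 3
  · obtain ⟨y, hy⟩ := h3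
    rcases card_eq_of_orderOf_eq_three hy hψ with hn | ⟨x, hx, hc, hn | hn | hn⟩
    · left
      have : Fact (Nat.Prime 3) := ⟨Nat.prime_three⟩
      exact ⟨mulEquivOfPrimeCardEq (p := 3) (by rw [Nat.card_eq_fintype_card, hn])
        (card_cyc 3)⟩
    · exact .inr (.inr (.inl (nonempty_mulEquiv_perm_fin_three hy hx hn)))
    · have := le_sumOrders_of_card_eq_twelve hy hn (by omega)
      omega
    · exact .inr (.inr (.inr (.inl
        (nonempty_mulEquiv_genDihedral_of_card_eq_eighteen hy hx hn (by omega) (by omega)))))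
  · push Not at h3
    have h4 := card_mul_le_sumOrders_add (G := G) 2 fun x hx =>
      lt_of_le_of_ne (three_le_orderOf hx) (h3 x).symm
    by_cases hi : 3 * Fintype.card G < 4 * numInvolutive G
    · exact .inr (.inr (.inr (.inr (isElementaryAbelianGroup_two_of_card_lt hi))))
    · have h5 := numInvolutive_add_one_ne_card (G := G)
      have := Fintype.card_pos (α := G)
      -- The bounds 4n ≤ ψ + 2i + 1 and 4i ≤ 3n force n < 10; then i + 1 ≠ n removes (n, i) = (3, 2)
      -- and (4, 3), leaving (8, 6).
      exact .inr (.inl (nonempty_mulEquiv_dihedralGroup_four (by omega) (by omega) h3))
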